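/- Let $d \ge 0$ and $n = (n_0,\dots,n_d) \in \mathbb{Z}^{d+1}$ with $n_i \ge 2$ for all $i$. Let $D_0,\dots,D_d$ be pairwise disjoint sets (the color classes) with $|D_i| = n_i$, and let $D = D_0 \cup \dots \cup D_d$. A colorful simplex is a subset $\sigma \subseteq D$ with $|\sigma \cap D_i| \le 1$ for all $i$; its dimension is $|\sigma| - 1$. A colorful $n$-configuration is a map $f : D \to \mathbb{R}^d$, and for a colorful simplex $\sigma$ one puts $f(\sigma) = \operatorname{conv}\{f(v) : v \in \sigma\}$. The configuration $f$ is centered if $0$ lies in the relative interior of $\operatorname{conv} f(D_i)$ for every $i$; it is in relative general position if $0 \notin f(\tau)$ for every colorful simplex $\tau$ of dimension less than $d$. The avoiding complex of $f$ is the simplicial complex $A(f) = \{\sigma \text{ a colorful simplex} : 0 \notin f(\sigma)\}$. Then for every centered colorful $n$-configuration $f$ in relative general position, the $(d-1)$-st reduced Betti number of the avoiding complex over $\mathbb{Z}/2$ satisfies $$\tilde\beta_{d-1}(A(f)) = \dim_{\mathbb{Z}/2} \tilde H_{d-1}(A(f);\mathbb{Z}/2) = 1.$$ -/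

import Mathlib

/-! ### Reduced simplicial homology with coefficients in `ℤ/2` -/

namespace PreAbstractSimplicialComplex

/-- The faces of dimension `k` (that is, with `k + 1` vertices) of `K`, where the empty set counts
as the unique face of dimension `-1`. -/
def augmentedFaces {V : Type*} (K : PreAbstractSimplicialComplex V) (k : ℤ) : Set (Finset V) :=
  {σ | (σ ∈ K ∨ σ = ∅) ∧ (σ.card : ℤ) = k + 1}

/-- The `ℤ/2`-linear boundary map: it sends a finite set `σ` to the sum of all subsets of `σ` with
exactly one element less. -/
noncomputable def boundaryMap (V : Type*) [DecidableEq V] :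
    (Finset V →₀ ZMod 2) →ₗ[ZMod 2] (Finset V →₀ ZMod 2) :=
  Finsupp.linearCombination (ZMod 2) fun σ : Finset V =>
    ∑ v ∈ σ, Finsupp.single (σ.erase v) (1 : ZMod 2)

/-- The augmented `k`-chains of `K`: the `ℤ/2`-vector space with basis the faces of dimension `k`,
including `∅` for `k = -1`. -/
noncomputable def chains {V : Type*} (K : PreAbstractSimplicialComplex V) (k : ℤ) :
    Submodule (ZMod 2) (Finset V →₀ ZMod 2) :=
  Finsupp.supported (ZMod 2) (ZMod 2) (K.augmentedFaces k)

/-- The kernel of `∂ₖ : Cₖ → Cₖ₋₁`. -/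
noncomputable def cycles {V : Type*} [DecidableEq V] (K : PreAbstractSimplicialComplex V) (k : ℤ) :
    Submodule (ZMod 2) (Finset V →₀ ZMod 2) :=
  K.chains k ⊓ LinearMap.ker (boundaryMap V)

/-- The image of `∂ₖ₊₁ : Cₖ₊₁ → Cₖ`. -/
noncomputable def boundaries {V : Type*} [DecidableEq V] (K : PreAbstractSimplicialComplex V)
    (k : ℤ) : Submodule (ZMod 2) (Finset V →₀ ZMod 2) :=
  (K.chains (k + 1)).map (boundaryMap V)

/-- The quotient `Z / (B ∩ Z)` of two submodules, which is `Z / B` when `B ≤ Z`. -/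
abbrev subquotient {R M : Type*} [Ring R] [AddCommGroup M] [Module R M] (Z B : Submodule R M) :
    Type _ :=
  Z ⧸ B.submoduleOf Z

/-- The `k`-th reduced homology group `ker ∂ₖ / im ∂ₖ₊₁` with coefficients in `ℤ/2`. -/
abbrev ReducedHomology {V : Type*} [DecidableEq V] (K : PreAbstractSimplicialComplex V) (k : ℤ) :
    Type _ :=
  subquotient (K.cycles k) (K.boundaries k)

/-- The `k`-th reduced Betti number over `ℤ/2`. -/
noncomputable def reducedBetti {V : Type*} [DecidableEq V] (K : PreAbstractSimplicialComplex V)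
    (k : ℤ) : ℕ :=
  Module.finrank (ZMod 2) (K.ReducedHomology k)

end PreAbstractSimplicialComplex

/-! ### Colorful configurations -/

namespace Colorful

/-- The disjoint union of the color classes `Dᵢ`, where `Dᵢ` has `n i` elements. -/
abbrev Vertex {d : ℕ} (n : Fin (d + 1) → ℕ) : Type :=
  Σ i : Fin (d + 1), Fin (n i)

/-- The colorful complex `D₀ * ⋯ * D_d`: its simplices are the (nonempty) vertex sets that contain
at most one vertex of each color. -/
def complex {d : ℕ} (n : Fin (d + 1) → ℕ) : PreAbstractSimplicialComplex (Vertex n) where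
  faces := {σ | σ.Nonempty ∧ ∀ i, (σ.filter fun v => v.1 = i).card ≤ 1}
  isRelLowerSet_faces := fun _ hσ =>
    ⟨hσ.1, fun _ hτσ hτ =>
      ⟨hτ, fun i => (Finset.card_le_card (Finset.filter_subset_filter _ hτσ)).trans (hσ.2 i)⟩⟩

/-- `f(σ)`, the convex hull of the images of the vertices of `σ`. -/
def image {d : ℕ} {n : Fin (d + 1) → ℕ} (f : Vertex n → EuclideanSpace ℝ (Fin d))
    (σ : Finset (Vertex n)) : Set (EuclideanSpace ℝ (Fin d)) :=
  convexHull ℝ (f '' (σ : Set (Vertex n)))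

/-- A configuration is centered if the origin lies in the relative interior of the convex hull of
each color class. -/
def IsCentered {d : ℕ} {n : Fin (d + 1) → ℕ} (f : Vertex n → EuclideanSpace ℝ (Fin d)) : Prop :=
  ∀ i : Fin (d + 1),
    (0 : EuclideanSpace ℝ (Fin d)) ∈
      intrinsicInterior ℝ (convexHull ℝ (Set.range fun j : Fin (n i) => f ⟨i, j⟩))

/-- A configuration is in relative general position if no colorful simplex of dimension less than
`d` (that is, with at most `d` vertices) contains the origin in its image. -/
def InRelativeGeneralPosition {d : ℕ} {n : Fin (d + 1) → ℕ}
    (f : Vertex n → EuclideanSpace ℝ (Fin d)) : Prop :=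
  ∀ τ ∈ complex n, τ.card ≤ d → (0 : EuclideanSpace ℝ (Fin d)) ∉ image f τ

/-- The avoiding complex: all colorful simplices whose image does not contain the origin. -/
def avoidingComplex {d : ℕ} {n : Fin (d + 1) → ℕ} (f : Vertex n → EuclideanSpace ℝ (Fin d)) :
    PreAbstractSimplicialComplex (Vertex n) where
  faces := {σ | σ ∈ complex n ∧ (0 : EuclideanSpace ℝ (Fin d)) ∉ image f σ}
  isRelLowerSet_faces := fun _ hσ =>
    ⟨((complex n).isRelLowerSet_faces hσ.1).1, fun _ hτσ hτ =>
      ⟨((complex n).isRelLowerSet_faces hσ.1).2 hτσ hτ, fun h0 =>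
        hσ.2 (convexHull_mono (Set.image_mono (Finset.coe_subset.mpr hτσ)) h0)⟩⟩

end Colorful

/-!
A colorful simplex `σ` avoids the origin exactly when some linear functional `u` is positive on
`f(σ)`. For a subspace `L` and a convex open set `O` let `B(L, O)` be the family of colorful
simplices on which some `u ∈ L ∩ O` is positive (`positiveFamily`); the avoiding complex, with the
empty set added, is `B(⊤, univ)`. If `q` is not orthogonal to `L`, then `B(L, O)` is the union of
`B(L, O ∩ {q > 0})` and `B(L, O ∩ {q < 0})`, which meet in `B(L ∩ qᗮ, O)`, because positivity
on a simplex is an open and convex condition on `u`. So Mayer–Vietoris sequences apply.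

If `0 ∉ O` and `L ∩ O` is nonempty, then `B(L, O)` is acyclic in dimensions below `dim L`
(`acyclic_positiveFamily`). Cutting along vertices reduces this to the case in which no vertex
changes sign on `L ∩ O`. Then `B(L, O)` is the join of the sets of positive vertices of the single
colors, and a join of `r` nonempty finite sets is acyclic in dimensions below `r - 1`. Since `f` is
centered, a color without positive vertex is orthogonal to `L`. By relative general position and
the colorful Carathéodory theorem, `s ≤ d` color classes span a space of dimension at least `s`, so
at most `d - dim L` colors are missing, and `r ≥ dim L + 1`.

Cutting `B(L, univ)` by some `q ∈ L` then shows that its reduced homology is that of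
`B(L ∩ qᗮ, univ)`, shifted by one. After `dim L` steps only the empty set is left, whose reduced
homology is one-dimensional, in dimension `-1` (`hasUniqueClass_positiveFamily`).
-/

/-! ### Mod 2 homology of families of finite sets -/

namespace SetFamily

open PreAbstractSimplicialComplex

variable {V : Type*}

/-- The mod 2 chains spanned by the members of `K` with `k` elements. Chains are indexed by
cardinality, so that the empty set, of dimension `-1`, has index `0`. -/
def chains (K : Set (Finset V)) (k : ℕ) : Submodule (ZMod 2) (Finset V →₀ ZMod 2) :=
  Finsupp.supported (ZMod 2) (ZMod 2) {σ | σ ∈ K ∧ σ.card = k}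

lemma chains_mono {K K' : Set (Finset V)} (h : K ⊆ K') (k : ℕ) : chains K k ≤ chains K' k :=
  Finsupp.supported_mono fun _ hσ => ⟨h hσ.1, hσ.2⟩

lemma chains_union (K K' : Set (Finset V)) (k : ℕ) :
    chains (K ∪ K') k = chains K k ⊔ chains K' k := by
  rw [chains, chains, chains, ← Finsupp.supported_union]
  congr 1
  ext σ
  simp only [Set.mem_ofPred_eq, Set.mem_union]
  tauto

lemma mem_chains_inter {K K' : Set (Finset V)} {k : ℕ} {z : Finset V →₀ ZMod 2}
    (h : z ∈ chains K k) (h' : z ∈ chains K' k) : z ∈ chains (K ∩ K') k := by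
  rw [chains, Finsupp.mem_supported] at *
  exact fun σ hσ => ⟨⟨(h hσ).1, (h' hσ).1⟩, (h hσ).2⟩

lemma single_mem_chains {K : Set (Finset V)} {σ : Finset V} (h : σ ∈ K) :
    Finsupp.single σ (1 : ZMod 2) ∈ chains K σ.card :=
  Finsupp.single_mem_supported _ _ ⟨h, rfl⟩

/-- The augmented chains of a simplicial complex are those of its faces together with `∅`. -/
lemma augmentedChains_eq {K : PreAbstractSimplicialComplex V}
    {F : Set (Finset V)} (h : ∀ σ, σ ∈ F ↔ σ ∈ K ∨ σ = ∅) {k : ℤ} {m : ℕ} (hk : k + 1 = m) :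
    K.chains k = chains F m := by
  rw [PreAbstractSimplicialComplex.chains, chains, PreAbstractSimplicialComplex.augmentedFaces]
  congr 1
  ext σ
  simp only [Set.mem_ofPred_eq, h, hk, Nat.cast_inj]

/-- A linear map sends `chains K k` into a submodule as soon as it does so on the basis. -/
lemma chains_le_comap {M : Type*} [AddCommGroup M] [Module (ZMod 2) M] {K : Set (Finset V)}
    {k : ℕ} {φ : (Finset V →₀ ZMod 2) →ₗ[ZMod 2] M} {N : Submodule (ZMod 2) M}
    (h : ∀ σ ∈ K, σ.card = k → φ (Finsupp.single σ 1) ∈ N) :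
    chains K k ≤ N.comap φ := by
  rw [chains, Finsupp.supported_eq_span_single, Submodule.span_le]
  rintro _ ⟨σ, hσ, rfl⟩
  exact h σ hσ.1 hσ.2

/-- In characteristic two, signs disappear. -/
lemma add_self_eq_zero' (z : Finset V →₀ ZMod 2) : z + z = 0 := by
  ext σ
  exact CharTwo.add_self_eq_zero _

lemma eq_of_add_eq_zero' {a b : Finset V →₀ ZMod 2} (h : a + b = 0) : a = b := by
  have := add_self_eq_zero' b
  exact add_right_cancel (h.trans this.symm)

variable [DecidableEq V]

lemma boundaryMap_single (σ : Finset V) :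
    boundaryMap V (Finsupp.single σ 1) = ∑ v ∈ σ, Finsupp.single (σ.erase v) (1 : ZMod 2) := by
  simp [boundaryMap]

lemma boundaryMap_mem_chains {K : Set (Finset V)} (hK : IsLowerSet K) {k : ℕ}
    {z : Finset V →₀ ZMod 2} (hz : z ∈ chains K (k + 1)) : boundaryMap V z ∈ chains K k := by
  refine chains_le_comap (φ := boundaryMap V) (N := chains K k) (fun σ hσ hc => ?_) hz
  rw [boundaryMap_single]
  refine Submodule.sum_mem _ fun v hv => ?_
  have : (σ.erase v).card = k := by rw [Finset.card_erase_of_mem hv, hc]; rfl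
  exact this ▸ single_mem_chains (hK (Finset.erase_subset v σ) hσ)

lemma boundaryMap_of_mem_chains_zero {K : Set (Finset V)} {z : Finset V →₀ ZMod 2}
    (hz : z ∈ chains K 0) : boundaryMap V z = 0 := by
  have := chains_le_comap (φ := boundaryMap V) (N := ⊥) (K := K) (k := 0) (fun σ _ hc => by
    rw [Finset.card_eq_zero] at hc
    simp [hc, boundaryMap_single]) hz
  simpa using this

lemma boundaryMap_boundaryMap (z : Finset V →₀ ZMod 2) : boundaryMap V (boundaryMap V z) = 0 := by
  suffices h : boundaryMap V ∘ₗ boundaryMap V = 0 from DFunLike.congr_fun h z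
  refine Finsupp.lhom_ext' fun σ => LinearMap.ext_ring ?_
  simp only [LinearMap.comp_apply, Finsupp.lsingle_apply, LinearMap.zero_comp,
    LinearMap.zero_apply, boundaryMap_single, map_sum]
  rw [Finset.sum_sigma']
  -- Removing `v` and then `w` cancels against removing `w` and then `v`.
  refine Finset.sum_involution (fun p _ => ⟨p.2, p.1⟩) ?_ ?_ ?_ ?_
  · rintro ⟨v, w⟩ _
    simp only
    rw [Finset.erase_right_comm, add_self_eq_zero']
  · rintro ⟨v, w⟩ h _ he
    simp only [Finset.mem_sigma, Finset.mem_erase] at h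
    exact h.2.1 (congrArg Sigma.fst he)
  · rintro ⟨v, w⟩ h
    simp only [Finset.mem_sigma, Finset.mem_erase] at h ⊢
    exact ⟨h.2.2, h.2.1.symm, h.1⟩
  · intro _ _
    rfl

/-- The `k`-element chains of `K` without boundary are boundaries: the reduced homology of `K`
vanishes in dimension `k - 1`. -/
def Acyclic (K : Set (Finset V)) (k : ℕ) : Prop :=
  ∀ z ∈ chains K k, boundaryMap V z = 0 → ∃ w ∈ chains K (k + 1), boundaryMap V w = z

/-- The reduced homology of `K` in dimension `k - 1` is one-dimensional, generated by the class of
some cycle. -/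
def HasUniqueClass (K : Set (Finset V)) (k : ℕ) : Prop :=
  ∃ z₀ ∈ chains K k, boundaryMap V z₀ = 0 ∧ (∀ w ∈ chains K (k + 1), boundaryMap V w ≠ z₀) ∧
    ∀ z ∈ chains K k, boundaryMap V z = 0 →
      ∃ w ∈ chains K (k + 1), boundaryMap V w = z ∨ boundaryMap V w = z + z₀

/-- The chain homotopy of a cone: it adds the apex `v` to the sets that do not contain it. -/
noncomputable def coneMap (v : V) : (Finset V →₀ ZMod 2) →ₗ[ZMod 2] (Finset V →₀ ZMod 2) :=
  Finsupp.linearCombination (ZMod 2) fun σ : Finset V =>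
    if v ∈ σ then 0 else Finsupp.single (insert v σ) (1 : ZMod 2)

lemma coneMap_single (v : V) (σ : Finset V) :
    coneMap v (Finsupp.single σ 1) =
      if v ∈ σ then 0 else Finsupp.single (insert v σ) (1 : ZMod 2) := by
  simp [coneMap]

lemma boundaryMap_coneMap (v : V) (z : Finset V →₀ ZMod 2) :
    boundaryMap V (coneMap v z) + coneMap v (boundaryMap V z) = z := by
  suffices h : boundaryMap V ∘ₗ coneMap v + coneMap v ∘ₗ boundaryMap V = LinearMap.id from
    DFunLike.congr_fun h z
  refine Finsupp.lhom_ext' fun σ => LinearMap.ext_ring ?_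
  simp only [LinearMap.comp_apply, Finsupp.lsingle_apply, LinearMap.add_apply, LinearMap.id_apply,
    boundaryMap_single, map_sum, coneMap_single]
  by_cases hv : v ∈ σ
  · rw [if_pos hv, map_zero, zero_add, Finset.sum_eq_single_of_mem v hv]
    · simp [Finset.insert_erase hv]
    · intro w _ hw
      rw [if_pos (Finset.mem_erase.2 ⟨hw.symm, hv⟩)]
  · rw [if_neg hv, boundaryMap_single, Finset.sum_insert hv, Finset.erase_insert hv, add_assoc,
      ← Finset.sum_add_distrib, Finset.sum_eq_zero, add_zero]
    intro w hw
    have hvw : v ≠ w := fun h => hv (h ▸ hw)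
    rw [if_neg fun h => hv (Finset.mem_of_mem_erase h), Finset.erase_insert_of_ne hvw,
      add_self_eq_zero']

/-- A cone is acyclic. -/
lemma acyclic_of_cone {K : Set (Finset V)} {v : V} (hv : ∀ σ ∈ K, insert v σ ∈ K) (k : ℕ) :
    Acyclic K k := by
  intro z hz hz0
  refine ⟨coneMap v z, ?_, ?_⟩
  · refine chains_le_comap (φ := coneMap v) (N := chains K (k + 1)) (fun σ hσ hc => ?_) hz
    rw [coneMap_single]
    split_ifs with h
    · exact zero_mem _
    · have : (insert v σ).card = k + 1 := by rw [Finset.card_insert_of_notMem h, hc]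
      exact this ▸ single_mem_chains (hv σ hσ)
  · have := boundaryMap_coneMap v z
    rwa [hz0, map_zero, add_zero] at this

/-- The Mayer–Vietoris decomposition of a cycle of a union. -/
lemma exists_split_cycle {K K' : Set (Finset V)} (hK : IsLowerSet K) (hK' : IsLowerSet K') {k : ℕ}
    {z : Finset V →₀ ZMod 2} (hz : z ∈ chains (K ∪ K') (k + 1)) (hz0 : boundaryMap V z = 0) :
    ∃ a ∈ chains K (k + 1), ∃ b ∈ chains K' (k + 1), a + b = z ∧
      boundaryMap V a = boundaryMap V b ∧ boundaryMap V a ∈ chains (K ∩ K') k := by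
  rw [chains_union] at hz
  obtain ⟨a, ha, b, hb, rfl⟩ := Submodule.mem_sup.1 hz
  have hab : boundaryMap V a = boundaryMap V b := eq_of_add_eq_zero' (by rw [← map_add, hz0])
  exact ⟨a, ha, b, hb, rfl, hab, mem_chains_inter (boundaryMap_mem_chains hK ha)
    (hab ▸ boundaryMap_mem_chains hK' hb)⟩

/-- If `a` and `b` have the same boundary as a chain `y` of `K ∩ K'`, then `a + b` bounds in
`K ∪ K'`. -/
lemma exists_boundary_of_common {K K' : Set (Finset V)} {k : ℕ} (h : Acyclic K k)
    (h' : Acyclic K' k) {a b y : Finset V →₀ ZMod 2} (ha : a ∈ chains K k) (hb : b ∈ chains K' k)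
    (hy : y ∈ chains (K ∩ K') k) (hya : boundaryMap V y = boundaryMap V a)
    (hyb : boundaryMap V y = boundaryMap V b) :
    ∃ w ∈ chains (K ∪ K') (k + 1), boundaryMap V w = a + b := by
  obtain ⟨p, hp, hpa⟩ := h (a + y) (add_mem ha (chains_mono Set.inter_subset_left _ hy))
    (by rw [map_add, hya, add_self_eq_zero'])
  obtain ⟨q, hq, hqb⟩ := h' (b + y) (add_mem hb (chains_mono Set.inter_subset_right _ hy))
    (by rw [map_add, hyb, add_self_eq_zero'])
  refine ⟨p + q, add_mem (chains_mono Set.subset_union_left _ hp)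
    (chains_mono Set.subset_union_right _ hq), ?_⟩
  rw [map_add, hpa, hqb, add_add_add_comm, add_self_eq_zero', add_zero]

/-- Mayer–Vietoris, in the form of an acyclicity criterion for a union. -/
lemma acyclic_union {K K' : Set (Finset V)} (hK : IsLowerSet K) (hK' : IsLowerSet K') {m : ℕ}
    (h : ∀ k < m + 1, Acyclic K k) (h' : ∀ k < m + 1, Acyclic K' k)
    (hi : ∀ k < m, Acyclic (K ∩ K') k) : ∀ k < m + 1, Acyclic (K ∪ K') k := by
  intro k hk z hz hz0
  cases k with
  | zero =>
    rw [chains_union] at hz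
    obtain ⟨a, ha, b, hb, rfl⟩ := Submodule.mem_sup.1 hz
    obtain ⟨p, hp, rfl⟩ := h 0 hk a ha (boundaryMap_of_mem_chains_zero ha)
    obtain ⟨q, hq, rfl⟩ := h' 0 hk b hb (boundaryMap_of_mem_chains_zero hb)
    exact ⟨p + q, add_mem (chains_mono Set.subset_union_left _ hp)
      (chains_mono Set.subset_union_right _ hq), map_add _ _ _⟩
  | succ k =>
    obtain ⟨a, ha, b, hb, rfl, hab, hmem⟩ := exists_split_cycle hK hK' hz hz0
    obtain ⟨y, hy, hya⟩ := hi k (by omega) _ hmem (boundaryMap_boundaryMap a)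
    exact exists_boundary_of_common (h _ hk) (h' _ hk) ha hb hy hya (hya.trans hab)

/-- Mayer–Vietoris, in the form of a suspension isomorphism: the union of two acyclic families has
the homology of their intersection, shifted by one. -/
lemma hasUniqueClass_union {K K' : Set (Finset V)} (hK : IsLowerSet K) (hK' : IsLowerSet K')
    {m : ℕ} (h : ∀ k < m + 2, Acyclic K k) (h' : ∀ k < m + 2, Acyclic K' k)
    (hi : HasUniqueClass (K ∩ K') m) : HasUniqueClass (K ∪ K') (m + 1) := by
  obtain ⟨z₀, hz₀, hz₀0, hne, huniq⟩ := hi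
  obtain ⟨a, ha, haz⟩ := h m (by omega) z₀ (chains_mono Set.inter_subset_left _ hz₀) hz₀0
  obtain ⟨b, hb, hbz⟩ := h' m (by omega) z₀ (chains_mono Set.inter_subset_right _ hz₀) hz₀0
  refine ⟨a + b, add_mem (chains_mono Set.subset_union_left _ ha)
    (chains_mono Set.subset_union_right _ hb), ?_, ?_, ?_⟩
  · rw [map_add, haz, hbz, add_self_eq_zero']
  · intro w hw hwab
    rw [chains_union] at hw
    obtain ⟨p, hp, q, hq, rfl⟩ := Submodule.mem_sup.1 hw
    -- `a + ∂p = b + ∂q` lies in the intersection and has boundary `z₀`.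
    have hpq : a + boundaryMap V p = b + boundaryMap V q := by
      apply eq_of_add_eq_zero'
      rw [add_add_add_comm, ← hwab, map_add, add_self_eq_zero']
    refine hne (a + boundaryMap V p) (mem_chains_inter
      (add_mem ha (boundaryMap_mem_chains hK hp))
      (hpq ▸ add_mem hb (boundaryMap_mem_chains hK' hq))) ?_
    rw [map_add, haz, boundaryMap_boundaryMap, add_zero]
  · intro z hz hz0
    obtain ⟨c, hc, e, he, rfl, hce, hmem⟩ := exists_split_cycle hK hK' hz hz0
    obtain ⟨y, hy, hyc | hyc⟩ := huniq _ hmem (boundaryMap_boundaryMap c)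
    · obtain ⟨w, hw, hwz⟩ := exists_boundary_of_common (h _ (by omega)) (h' _ (by omega)) hc he hy
        hyc (hyc.trans hce)
      exact ⟨w, hw, Or.inl hwz⟩
    · obtain ⟨w, hw, hwz⟩ := exists_boundary_of_common (h _ (by omega)) (h' _ (by omega))
        (add_mem hc ha) (add_mem he hb) hy (by rw [hyc, map_add, haz])
        (by rw [hyc, map_add, hbz, hce])
      exact ⟨w, hw, Or.inr (by rw [hwz, add_add_add_comm])⟩

lemma reducedBetti_eq_one {K : PreAbstractSimplicialComplex V} {F : Set (Finset V)}
    (h : ∀ σ, σ ∈ F ↔ σ ∈ K ∨ σ = ∅) {m : ℕ} (hF : HasUniqueClass F m) :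
    K.reducedBetti ((m : ℤ) - 1) = 1 := by
  obtain ⟨z₀, hz₀, hz₀0, hne, huniq⟩ := hF
  have hcyc : ∀ z, z ∈ K.cycles ((m : ℤ) - 1) ↔ z ∈ chains F m ∧ boundaryMap V z = 0 := by
    intro z
    rw [PreAbstractSimplicialComplex.cycles, Submodule.mem_inf, LinearMap.mem_ker,
      augmentedChains_eq h (m := m) (by ring)]
  have hbd : ∀ z, z ∈ K.boundaries ((m : ℤ) - 1) ↔
      ∃ w ∈ chains F (m + 1), boundaryMap V w = z := by
    intro z
    rw [PreAbstractSimplicialComplex.boundaries, Submodule.mem_map,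
      augmentedChains_eq h (m := m + 1) (by push_cast; ring)]
  refine finrank_eq_one_iff'.2
    ⟨Submodule.Quotient.mk ⟨z₀, (hcyc z₀).2 ⟨hz₀, hz₀0⟩⟩, ?_, fun x => ?_⟩
  · rw [Ne, Submodule.Quotient.mk_eq_zero, Submodule.submoduleOf,
      Submodule.mem_comap, Submodule.subtype_apply, hbd]
    rintro ⟨w, hw, hwz⟩
    exact hne w hw hwz
  · obtain ⟨⟨z, hz⟩, rfl⟩ := Submodule.Quotient.mk_surjective _ x
    obtain ⟨hz1, hz2⟩ := (hcyc z).1 hz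
    obtain ⟨w, hw, hwz | hwz⟩ := huniq z hz1 hz2
    · refine ⟨0, ?_⟩
      rw [zero_smul, eq_comm, Submodule.Quotient.mk_eq_zero, Submodule.submoduleOf,
        Submodule.mem_comap, Submodule.subtype_apply, hbd]
      exact ⟨w, hw, hwz⟩
    · refine ⟨1, ?_⟩
      rw [one_smul, eq_comm, Submodule.Quotient.eq, Submodule.submoduleOf,
        Submodule.mem_comap, Submodule.subtype_apply, hbd]
      refine ⟨w, hw, hwz.trans ?_⟩
      change z + z₀ = z - z₀
      rw [eq_sub_iff_add_eq, add_assoc, add_self_eq_zero', add_zero]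

end SetFamily

/-! ### Joins of color classes -/

namespace Colorful

open SetFamily

variable {V ι : Type*}

/-- The finite sets of vertices in `G` without two vertices of the same color, the empty set
included. This is the join of the color classes of `G`. -/
def rainbow (c : V → ι) (G : Set V) : Set (Finset V) :=
  {σ | (σ : Set V) ⊆ G ∧ Set.InjOn c σ}

lemma isLowerSet_rainbow (c : V → ι) (G : Set V) : IsLowerSet (rainbow c G) := fun _ _ hτσ hσ =>
  ⟨(Finset.coe_subset.2 hτσ).trans hσ.1, hσ.2.mono (Finset.coe_subset.2 hτσ)⟩

/-- If `v` is the only vertex of its color, the join is a cone with apex `v`. -/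
lemma acyclic_rainbow_of_unique [DecidableEq V] {c : V → ι} {G : Set V} {v : V} (hv : v ∈ G)
    (huniq : ∀ x ∈ G, c x = c v → x = v) (k : ℕ) : Acyclic (rainbow c G) k := by
  apply acyclic_of_cone (v := v)
  rintro σ ⟨hσ, hinj⟩
  have hσ' : ((insert v σ : Finset V) : Set V) ⊆ G := by
    rw [Finset.coe_insert]
    exact Set.insert_subset hv hσ
  refine ⟨hσ', fun x hx y hy hxy => ?_⟩
  have hx' := hσ' hx
  have hy' := hσ' hy
  rw [Finset.coe_insert] at hx hy
  rcases hx with rfl | hx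
  · exact (huniq y hy' hxy.symm).symm
  · rcases hy with rfl | hy
    · exact huniq x hx' hxy
    · exact hinj hx hy hxy

/-- The join of `r` nonempty color classes is acyclic below its top dimension `r - 1`. -/
lemma acyclic_rainbow [DecidableEq V] [DecidableEq ι] (c : V → ι) (G : Finset V) :
    ∀ k < (G.image c).card, Acyclic (rainbow c (G : Set V)) k := by
  induction G using Finset.strongInduction with
  | H G ih =>
    rcases G.eq_empty_or_nonempty with rfl | ⟨v, hv⟩
    · simp
    by_cases hG : ∃ w ∈ G, w ≠ v ∧ c w = c v
    · obtain ⟨w, hw, hwv, hcw⟩ := hG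
      -- A set without repeated colors avoids either `v` or all other vertices of the same color.
      set G₁ := G.erase v with hG₁
      set G₂ := G.filter fun x => c x = c v → x = v with hG₂
      set G₃ := G.filter fun x => c x ≠ c v with hG₃
      have hunion : rainbow c (G : Set V) = rainbow c (G₁ : Set V) ∪ rainbow c (G₂ : Set V) := by
        ext σ
        constructor
        · rintro ⟨hσ, hinj⟩
          by_cases hvσ : v ∈ σ
          · refine Or.inr ⟨fun x hx => ?_, hinj⟩
            simp only [hG₂, Finset.coe_filter, Set.mem_ofPred_eq]
            exact ⟨hσ hx, fun h => hinj hx hvσ h⟩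
          · refine Or.inl ⟨fun x hx => ?_, hinj⟩
            simp only [hG₁, Finset.coe_erase, Set.mem_sdiff, Set.mem_singleton_iff]
            exact ⟨hσ hx, fun h => hvσ (h ▸ hx)⟩
        · rintro (⟨hσ, hinj⟩ | ⟨hσ, hinj⟩)
          · exact ⟨hσ.trans (Finset.coe_subset.2 (Finset.erase_subset _ _)), hinj⟩
          · exact ⟨hσ.trans (Finset.coe_subset.2 (Finset.filter_subset _ _)), hinj⟩
      have hinter : rainbow c (G₁ : Set V) ∩ rainbow c (G₂ : Set V) = rainbow c (G₃ : Set V) := by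
        ext σ
        constructor
        · rintro ⟨⟨h1, hinj⟩, ⟨h2, _⟩⟩
          refine ⟨fun x hx => ?_, hinj⟩
          have h1 := h1 hx
          have h2 := h2 hx
          simp only [hG₁, hG₂, hG₃, Finset.coe_filter, Finset.coe_erase, Set.mem_sdiff,
            Set.mem_singleton_iff, Set.mem_ofPred_eq, Finset.mem_coe] at h1 h2 ⊢
          exact ⟨h1.1, fun h => h1.2 (h2.2 h)⟩
        · rintro ⟨h3, hinj⟩
          refine ⟨⟨fun x hx => ?_, hinj⟩, ⟨fun x hx => ?_, hinj⟩⟩ <;>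
          · have h3 := h3 hx
            simp only [hG₁, hG₂, hG₃, Finset.coe_filter, Finset.coe_erase, Set.mem_sdiff,
              Set.mem_singleton_iff, Set.mem_ofPred_eq, Finset.mem_coe] at h3 ⊢
            grind
      have himage : G₁.image c = G.image c := by
        ext i
        simp only [hG₁, Finset.mem_image, Finset.mem_erase]
        constructor
        · rintro ⟨x, ⟨_, hx⟩, rfl⟩
          exact ⟨x, hx, rfl⟩
        · rintro ⟨x, hx, rfl⟩
          by_cases hxv : x = v
          · exact ⟨w, ⟨hwv, hw⟩, hxv ▸ hcw⟩
          · exact ⟨x, ⟨hxv, hx⟩, rfl⟩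
      have himage₃ : G₃.image c = (G.image c).erase (c v) := by
        ext i
        simp only [hG₃, Finset.mem_image, Finset.mem_erase, Finset.mem_filter]
        constructor
        · rintro ⟨x, ⟨hx, hne⟩, rfl⟩
          exact ⟨hne, x, hx, rfl⟩
        · rintro ⟨hne, x, hx, rfl⟩
          exact ⟨x, ⟨hx, hne⟩, rfl⟩
      have hcard := Finset.card_erase_add_one (Finset.mem_image_of_mem c hv)
      rw [← himage₃] at hcard
      rw [hunion, ← hcard]
      refine acyclic_union (isLowerSet_rainbow _ _) (isLowerSet_rainbow _ _) ?_ ?_ ?_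
      · rw [hcard, ← himage]
        exact ih G₁ (Finset.erase_ssubset hv)
      · refine fun k _ => acyclic_rainbow_of_unique (v := v) ?_ ?_ k
        · simp [hG₂, hv]
        · simp [hG₂]
      · rw [hinter]
        refine ih G₃ (Finset.filter_ssubset.2 ⟨v, hv, by simp⟩)
    · push Not at hG
      exact fun k _ => acyclic_rainbow_of_unique (v := v) hv
        (fun x hx hxv => by_contra fun hne => hG x hx hne hxv) k

end Colorful

/-! ### Simplices that are positive for a functional in a cone -/

namespace Colorful

open SetFamily
open scoped RealInnerProductSpace

section Cones

variable {E : Type*} [NormedAddCommGroup E] [InnerProductSpace ℝ E]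

lemma isOpen_inner_pos (q : E) : IsOpen {u : E | 0 < ⟪q, u⟫} :=
  isOpen_lt continuous_const (by fun_prop)

lemma convex_inner_pos (q : E) : Convex ℝ {u : E | 0 < ⟪q, u⟫} :=
  convex_halfSpace_gt (innerₛₗ ℝ q).isLinear 0

lemma exists_pos_add_smul_mem {O : Set E} (hO : IsOpen O) {u : E} (hu : u ∈ O) (w : E) :
    ∃ ε > (0 : ℝ), u + ε • w ∈ O := by
  have h : ContinuousAt (fun t : ℝ => u + t • w) 0 := by fun_prop
  have hmem : ∀ᶠ t in nhds (0 : ℝ), u + t • w ∈ O :=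
    h.eventually_mem (hO.mem_nhds (by simpa using hu))
  obtain ⟨t, ht, htO⟩ := ((hmem.filter_mono nhdsWithin_le_nhds).and
    (self_mem_nhdsWithin : Set.Ioi (0 : ℝ) ∈ nhdsWithin 0 (Set.Ioi 0))).exists
  exact ⟨t, htO, ht⟩

/-- A nonempty relatively open part of `L` that lies on the nonpositive side of `q`, where `q` is
not orthogonal to `L`, has a point on the strictly negative side. -/
lemma exists_inner_neg {L : Submodule ℝ E} {O : Set E} (hO : IsOpen O) {q w u : E} (hw : w ∈ L)
    (hqw : ⟪q, w⟫ ≠ 0) (hu : u ∈ L) (huO : u ∈ O) (hqu : ⟪q, u⟫ ≤ 0) :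
    ∃ u' ∈ L, u' ∈ O ∧ ⟪q, u'⟫ < 0 := by
  obtain ⟨ε, hε, hmem⟩ := exists_pos_add_smul_mem hO huO (-⟪q, w⟫ • w)
  refine ⟨_, add_mem hu (L.smul_mem _ (L.smul_mem _ hw)), hmem, ?_⟩
  rw [inner_add_right, real_inner_smul_right, real_inner_smul_right]
  have : 0 < ε * (⟪q, w⟫ * ⟪q, w⟫) := mul_pos hε (mul_self_pos.2 hqw)
  linarith

lemma exists_inner_eq_zero {L : Submodule ℝ E} {O : Set E} (hO : Convex ℝ O) {q u u' : E}
    (hu : u ∈ L) (huO : u ∈ O) (hu' : u' ∈ L) (huO' : u' ∈ O) (hpos : 0 < ⟪q, u⟫)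
    (hneg : ⟪q, u'⟫ < 0) : ∃ x ∈ L ⊓ (ℝ ∙ q)ᗮ, x ∈ O := by
  have hs : 0 < ⟪q, u⟫ - ⟪q, u'⟫ := by linarith
  refine ⟨(-⟪q, u'⟫ / (⟪q, u⟫ - ⟪q, u'⟫)) • u + (⟪q, u⟫ / (⟪q, u⟫ - ⟪q, u'⟫)) • u',
    ⟨add_mem (L.smul_mem _ hu) (L.smul_mem _ hu'), ?_⟩,
    hO huO huO' (div_nonneg (by linarith) hs.le) (div_nonneg hpos.le hs.le) ?_⟩
  · rw [SetLike.mem_coe, Submodule.mem_orthogonal_singleton_iff_inner_right, inner_add_right,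
      real_inner_smul_right, real_inner_smul_right]
    field_simp
    ring
  · field_simp
    ring

lemma finrank_inf_orthogonal_add_one [FiniteDimensional ℝ E] {L : Submodule ℝ E} {q w : E}
    (hw : w ∈ L) (hqw : ⟪q, w⟫ ≠ 0) :
    Module.finrank ℝ ↥(L ⊓ (ℝ ∙ q)ᗮ) + 1 = Module.finrank ℝ L := by
  set φ : L →ₗ[ℝ] ℝ := (innerₛₗ ℝ q).domRestrict L with hφ
  have hsurj : LinearMap.range φ = ⊤ := by
    refine LinearMap.range_eq_top.2 (LinearMap.surjective fun h => hqw ?_)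
    exact DFunLike.congr_fun h ⟨w, hw⟩
  have hker : (LinearMap.ker φ).map L.subtype = L ⊓ (ℝ ∙ q)ᗮ := by
    ext x
    simp [hφ, Submodule.mem_orthogonal_singleton_iff_inner_right, and_comm]
  have := φ.finrank_range_add_finrank_ker
  rw [hsurj, finrank_top, Module.finrank_self] at this
  rw [← hker, Submodule.finrank_map_subtype_eq, add_comm, this]

end Cones

variable {V ι E : Type*} [NormedAddCommGroup E] [InnerProductSpace ℝ E]

/-- The set of functionals (given by vectors, through the inner product) that are positive on the
images of all vertices of `σ`. -/
def positiveSet (f : V → E) (σ : Finset V) : Set E :=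
  ⋂ v ∈ σ, {u | 0 < ⟪f v, u⟫}

lemma mem_positiveSet {f : V → E} {σ : Finset V} {u : E} :
    u ∈ positiveSet f σ ↔ ∀ v ∈ σ, 0 < ⟪f v, u⟫ := by
  simp [positiveSet]

lemma isOpen_positiveSet (f : V → E) (σ : Finset V) : IsOpen (positiveSet f σ) :=
  isOpen_biInter_finset fun v _ => isOpen_inner_pos (f v)

lemma convex_positiveSet (f : V → E) (σ : Finset V) : Convex ℝ (positiveSet f σ) :=
  convex_iInter₂ fun v _ => convex_inner_pos (f v)

/-- The colorful simplices (and the empty set) on which some functional in `L ∩ O` is positive. For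
`L = ⊤` and `O = univ` this is the avoiding complex. -/
def positiveFamily (c : V → ι) (f : V → E) (L : Submodule ℝ E) (O : Set E) : Set (Finset V) :=
  {σ | Set.InjOn c σ ∧ ∃ u ∈ L, u ∈ O ∧ u ∈ positiveSet f σ}

variable {c : V → ι} {f : V → E} {L : Submodule ℝ E} {O : Set E}

lemma isLowerSet_positiveFamily : IsLowerSet (positiveFamily c f L O) := by
  rintro σ τ hτσ ⟨hinj, u, hu, huO, hpos⟩
  exact ⟨hinj.mono (Finset.coe_subset.2 hτσ), u, hu, huO,
    mem_positiveSet.2 fun v hv => mem_positiveSet.1 hpos v (hτσ hv)⟩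

lemma positiveFamily_eq_union (hO : IsOpen O) {q w : E} (hw : w ∈ L) (hqw : ⟪q, w⟫ ≠ 0) :
    positiveFamily c f L O =
      positiveFamily c f L (O ∩ {u | 0 < ⟪q, u⟫}) ∪
        positiveFamily c f L (O ∩ {u | 0 < ⟪-q, u⟫}) := by
  ext σ
  constructor
  · rintro ⟨hinj, u, hu, huO, hpos⟩
    rcases lt_or_ge 0 ⟪q, u⟫ with h | h
    · exact Or.inl ⟨hinj, u, hu, ⟨huO, h⟩, hpos⟩
    · obtain ⟨u', hu', ⟨huO', hpos'⟩, hneg⟩ := exists_inner_neg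
        (hO.inter (isOpen_positiveSet f σ)) hw hqw hu ⟨huO, hpos⟩ h
      exact Or.inr ⟨hinj, u', hu', ⟨huO', by simpa [inner_neg_left] using hneg⟩, hpos'⟩
  · rintro (⟨hinj, u, hu, huO, hpos⟩ | ⟨hinj, u, hu, huO, hpos⟩) <;>
      exact ⟨hinj, u, hu, huO.1, hpos⟩

lemma positiveFamily_inter (hO : IsOpen O) (hOc : Convex ℝ O) {q w : E} (hw : w ∈ L)
    (hqw : ⟪q, w⟫ ≠ 0) :
    positiveFamily c f L (O ∩ {u | 0 < ⟪q, u⟫}) ∩ positiveFamily c f L (O ∩ {u | 0 < ⟪-q, u⟫}) =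
      positiveFamily c f (L ⊓ (ℝ ∙ q)ᗮ) O := by
  ext σ
  constructor
  · rintro ⟨⟨hinj, u, hu, ⟨huO, huq⟩, hpos⟩, ⟨-, u', hu', ⟨huO', huq'⟩, hpos'⟩⟩
    obtain ⟨x, hx, hxO, hxpos⟩ := exists_inner_eq_zero (hOc.inter (convex_positiveSet f σ)) hu
      ⟨huO, hpos⟩ hu' ⟨huO', hpos'⟩ huq (by simpa [inner_neg_left] using huq')
    exact ⟨hinj, x, hx, hxO, hxpos⟩
  · rintro ⟨hinj, u, ⟨hu, huq⟩, huO, hpos⟩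
    rw [SetLike.mem_coe, Submodule.mem_orthogonal_singleton_iff_inner_right] at huq
    have hopen := hO.inter (isOpen_positiveSet f σ)
    constructor
    · obtain ⟨u', hu', ⟨huO', hpos'⟩, hneg⟩ := exists_inner_neg (q := -q) hopen hw
        (by simpa [inner_neg_left] using hqw) hu ⟨huO, hpos⟩ (by simp [inner_neg_left, huq])
      exact ⟨hinj, u', hu', ⟨huO', by simpa [inner_neg_left] using hneg⟩, hpos'⟩
    · obtain ⟨u', hu', ⟨huO', hpos'⟩, hneg⟩ := exists_inner_neg hopen hw hqw hu ⟨huO, hpos⟩ huq.le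
      exact ⟨hinj, u', hu', ⟨huO', by simpa [inner_neg_left] using hneg⟩, hpos'⟩

/-- If every vertex that is positive somewhere on `L ∩ O` is positive on all of it, the positive
simplices are the rainbow sets of vertices positive at one point of `L ∩ O`. -/
lemma positiveFamily_eq_rainbow (hdec : ∀ v, ∀ u ∈ L, u ∈ O → ∀ u' ∈ L, u' ∈ O →
    0 < ⟪f v, u⟫ → 0 < ⟪f v, u'⟫) {u : E} (hu : u ∈ L) (huO : u ∈ O) :
    positiveFamily c f L O = rainbow c {v | 0 < ⟪f v, u⟫} := by
  ext σ
  constructor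
  · rintro ⟨hinj, u', hu', huO', hpos⟩
    exact ⟨fun v hv => hdec v u' hu' huO' u hu huO (mem_positiveSet.1 hpos v hv), hinj⟩
  · rintro ⟨hpos, hinj⟩
    exact ⟨hinj, u, hu, huO, mem_positiveSet.2 fun v hv => hpos hv⟩

/-- Over the zero space only the empty set is left, and it generates the homology in dimension
`-1`. -/
lemma hasUniqueClass_positiveFamily_bot [DecidableEq V] :
    HasUniqueClass (positiveFamily c f ⊥ Set.univ) 0 := by
  have hempty : ∀ σ ∈ positiveFamily c f ⊥ Set.univ, σ = ∅ := by
    rintro σ ⟨-, u, hu, -, hpos⟩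
    rw [Submodule.mem_bot] at hu
    refine Finset.eq_empty_of_forall_notMem fun v hv => ?_
    simpa [hu] using mem_positiveSet.1 hpos v hv
  have hmem : (∅ : Finset V) ∈ positiveFamily c f ⊥ Set.univ :=
    ⟨by simp, 0, zero_mem _, trivial, by simp [positiveSet]⟩
  refine ⟨Finsupp.single ∅ 1, single_mem_chains hmem,
    boundaryMap_of_mem_chains_zero (single_mem_chains hmem), fun w hw hw0 => ?_, fun z hz _ => ?_⟩
  · have hw' : w = 0 := by
      rw [chains, Finsupp.mem_supported] at hw
      rw [← Finsupp.support_eq_empty]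
      refine Finset.eq_empty_of_forall_notMem fun σ hσ => ?_
      have h := hw hσ
      simpa [hempty σ h.1] using h.2
    rw [hw', map_zero] at hw0
    exact Finsupp.single_ne_zero.2 one_ne_zero hw0.symm
  · have hz' : z = Finsupp.single ∅ (z ∅) := by
      rw [chains, Finsupp.mem_supported] at hz
      rw [← Finsupp.support_subset_singleton]
      exact fun σ hσ => Finset.mem_singleton.2 (hempty σ (hz hσ).1)
    refine ⟨0, zero_mem _, ?_⟩
    rw [map_zero, hz']
    have h01 : ∀ a : ZMod 2, a = 0 ∨ a = 1 := by decide
    rcases h01 (z ∅) with h | h <;> rw [h]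
    · exact Or.inl (Finsupp.single_zero _).symm
    · exact Or.inr (add_self_eq_zero' _).symm

/-- No functional is nonpositive on a color class unless it vanishes there. -/
def Balanced (c : V → ι) (f : V → E) : Prop :=
  ∀ i u, (∀ v, c v = i → ⟪f v, u⟫ ≤ 0) → ∀ v, c v = i → ⟪f v, u⟫ = 0

/-- If the number of colors is `dim E + 1`, this says that any `s ≤ dim E` color classes together
span a space of dimension at least `s`. It is expressed through the dimension of the nonzero spaces
orthogonal to given color classes. -/
def SpansEnough [Fintype ι] (c : V → ι) (f : V → E) : Prop :=
  ∀ (S : Finset ι) (L : Submodule ℝ E), L ≠ ⊥ → (∀ v, c v ∈ S → ∀ u ∈ L, ⟪f v, u⟫ = 0) →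
    S.card + Module.finrank ℝ L < Fintype.card ι

variable [Fintype V] [Fintype ι] [DecidableEq V]

/-- The case of `acyclic_positiveFamily` in which `L ∩ O` is not cut by any vertex. -/
lemma acyclic_positiveFamily_of_decided (hbal : Balanced c f) (hspan : SpansEnough c f)
    (hO : IsOpen O) (h0 : (0 : E) ∉ O) (hne : ∃ u ∈ L, u ∈ O)
    (hdec : ∀ v, ∀ u ∈ L, u ∈ O → ∀ u' ∈ L, u' ∈ O → 0 < ⟪f v, u⟫ → 0 < ⟪f v, u'⟫) :
    ∀ k < Module.finrank ℝ L + 1, Acyclic (positiveFamily c f L O) k := by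
  classical
  obtain ⟨u, hu, huO⟩ := hne
  have hL : L ≠ ⊥ := by
    rintro rfl
    rw [Submodule.mem_bot] at hu
    exact h0 (hu ▸ huO)
  set G : Finset V := Finset.univ.filter fun v => 0 < ⟪f v, u⟫ with hG
  -- A color without positive vertex is orthogonal to the open subset `L ∩ O` of `L`, hence to `L`.
  have horth : ∀ v, c v ∈ (G.image c)ᶜ → ∀ w ∈ L, ⟪f v, w⟫ = 0 := by
    intro v hv w hw
    by_contra hvw
    have hnonpos : ∀ x, c x = c v → ∀ u' ∈ L, u' ∈ O → ⟪f x, u'⟫ ≤ 0 := by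
      intro x hx u' hu' huO'
      by_contra! hpos
      refine Finset.mem_compl.1 hv (Finset.mem_image.2 ⟨x, ?_, hx⟩)
      simpa [hG] using hdec x u' hu' huO' u hu huO hpos
    obtain ⟨u', hu', huO', hneg⟩ :=
      exists_inner_neg hO hw hvw hu huO (hnonpos v rfl u hu huO)
    exact hneg.ne (hbal (c v) u' (fun x hx => hnonpos x hx u' hu' huO') v rfl)
  have hcard := hspan _ L hL horth
  have hcompl := Finset.card_compl_add_card (G.image c)
  have hfam : positiveFamily c f L O = rainbow c (G : Set V) := by
    rw [positiveFamily_eq_rainbow hdec hu huO]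
    simp [hG]
  rw [hfam]
  exact fun k hk => acyclic_rainbow c G k (by omega)

/-- The family of simplices that are positive somewhere on a nonempty convex open part of `L` away
from the origin is acyclic up to dimension `dim L - 1`. -/
lemma acyclic_positiveFamily [FiniteDimensional ℝ E] (hbal : Balanced c f)
    (hspan : SpansEnough c f) (hO : IsOpen O) (hOc : Convex ℝ O) (h0 : (0 : E) ∉ O)
    (hne : ∃ u ∈ L, u ∈ O) :
    ∀ k < Module.finrank ℝ L + 1, Acyclic (positiveFamily c f L O) k := by
  -- Induction on a set `Q` of vertices that may change sign on `L ∩ O`.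
  suffices h : ∀ (Q : Finset V) (L : Submodule ℝ E) (O : Set E), IsOpen O → Convex ℝ O →
      (0 : E) ∉ O → (∃ u ∈ L, u ∈ O) →
      (∀ v ∉ Q, ∀ u ∈ L, u ∈ O → ∀ u' ∈ L, u' ∈ O → 0 < ⟪f v, u⟫ → 0 < ⟪f v, u'⟫) →
      ∀ k < Module.finrank ℝ L + 1, Acyclic (positiveFamily c f L O) k from
    h Finset.univ L O hO hOc h0 hne fun v hv => absurd (Finset.mem_univ v) hv
  clear! L O
  intro Q
  induction Q using Finset.induction_on with
  | empty =>
    intro L O hO _ h0 hne hdec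
    exact acyclic_positiveFamily_of_decided hbal hspan hO h0 hne fun v => hdec v (by simp)
  | insert v Q _ ih =>
    intro L O hO hOc h0 hne hdec
    by_cases hv : ∀ u ∈ L, u ∈ O → ∀ u' ∈ L, u' ∈ O → 0 < ⟪f v, u⟫ → 0 < ⟪f v, u'⟫
    · refine ih L O hO hOc h0 hne fun x hx => ?_
      by_cases hxv : x = v
      · exact hxv ▸ hv
      · exact hdec x (by simp [hx, hxv])
    · push Not at hv
      obtain ⟨u, hu, huO, u', hu', huO', hpos, hnonpos⟩ := hv
      obtain ⟨w, hw, hwO, hneg⟩ := exists_inner_neg hO hu hpos.ne' hu' huO' hnonpos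
      have hdec' : ∀ (L' : Submodule ℝ E) (O' : Set E), L' ≤ L → O' ⊆ O →
          ((∀ y ∈ L', y ∈ O' → 0 < ⟪f v, y⟫) ∨ ∀ y ∈ L', y ∈ O' → ⟪f v, y⟫ ≤ 0) →
          ∀ x ∉ Q, ∀ y ∈ L', y ∈ O' → ∀ y' ∈ L', y' ∈ O' → 0 < ⟪f x, y⟫ → 0 < ⟪f x, y'⟫ := by
        intro L' O' hL' hO' hsign x hx y hy hyO y' hy' hyO' hxy
        by_cases hxv : x = v
        · subst hxv
          rcases hsign with h | h
          · exact h y' hy' hyO'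
          · exact absurd (h y hy hyO) hxy.not_ge
        · exact hdec x (by simp [hx, hxv]) y (hL' hy) (hO' hyO) y' (hL' hy') (hO' hyO') hxy
      rw [positiveFamily_eq_union hO hu hpos.ne']
      refine acyclic_union isLowerSet_positiveFamily isLowerSet_positiveFamily ?_ ?_ ?_
      · exact ih L _ (hO.inter (isOpen_inner_pos _)) (hOc.inter (convex_inner_pos _))
          (fun h => h0 h.1) ⟨u, hu, huO, hpos⟩
          (hdec' _ _ le_rfl Set.inter_subset_left (Or.inl fun y _ hy => hy.2))
      · refine ih L _ (hO.inter (isOpen_inner_pos _)) (hOc.inter (convex_inner_pos _))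
          (fun h => h0 h.1) ⟨w, hw, hwO, by simpa [inner_neg_left] using hneg⟩
          (hdec' _ _ le_rfl Set.inter_subset_left (Or.inr fun y _ hy => ?_))
        have : 0 < ⟪-f v, y⟫ := hy.2
        rw [inner_neg_left] at this
        linarith
      · rw [positiveFamily_inter hO hOc hu hpos.ne', ← finrank_inf_orthogonal_add_one hu hpos.ne']
        refine ih _ O hO hOc h0 (exists_inner_eq_zero hOc hu huO hw hwO hpos hneg)
          (hdec' _ _ inf_le_left subset_rfl (Or.inr fun y hy _ => ?_))
        exact (Submodule.mem_orthogonal_singleton_iff_inner_right.1 hy.2).le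

/-- The positive simplices over `L` have the homology of a sphere of dimension `dim L - 1` in
that dimension: each cut of `L` by a hyperplane is a suspension. -/
lemma hasUniqueClass_positiveFamily [FiniteDimensional ℝ E] (hbal : Balanced c f)
    (hspan : SpansEnough c f) (L : Submodule ℝ E) :
    HasUniqueClass (positiveFamily c f L Set.univ) (Module.finrank ℝ L) := by
  induction hm : Module.finrank ℝ L generalizing L with
  | zero => exact Submodule.finrank_eq_zero.1 hm ▸ hasUniqueClass_positiveFamily_bot
  | succ m ih =>
    obtain ⟨q, hq, hq0⟩ := L.exists_mem_ne_zero_of_ne_bot (by rintro rfl; simp at hm)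
    have hqq : 0 < ⟪q, q⟫ := real_inner_self_pos.2 hq0
    have hfin := finrank_inf_orthogonal_add_one hq hqq.ne'
    rw [positiveFamily_eq_union isOpen_univ hq hqq.ne']
    refine hasUniqueClass_union isLowerSet_positiveFamily isLowerSet_positiveFamily ?_ ?_ ?_
    · rw [show m + 2 = Module.finrank ℝ L + 1 by omega]
      exact acyclic_positiveFamily hbal hspan (isOpen_univ.inter (isOpen_inner_pos _))
        (convex_univ.inter (convex_inner_pos _)) (by simp) ⟨q, hq, trivial, hqq⟩
    · rw [show m + 2 = Module.finrank ℝ L + 1 by omega]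
      exact acyclic_positiveFamily hbal hspan (isOpen_univ.inter (isOpen_inner_pos _))
        (convex_univ.inter (convex_inner_pos _)) (by simp)
        ⟨-q, neg_mem hq, trivial, by simpa only [Set.mem_ofPred_eq, inner_neg_neg] using hqq⟩
    · rw [positiveFamily_inter isOpen_univ convex_univ hq hqq.ne']
      exact ih _ (by omega)

end Colorful

/-! ### The colorful Carathéodory theorem -/

namespace Colorful

open SetFamily
open scoped RealInnerProductSpace

section Caratheodory

variable {V ι E : Type*} [NormedAddCommGroup E] [InnerProductSpace ℝ E]

lemma inner_self_le_inner_of_forall_norm_le {K : Set E} (hK : Convex ℝ K) {p : E} (hp : p ∈ K)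
    (hmin : ∀ y ∈ K, ‖p‖ ≤ ‖y‖) {y : E} (hy : y ∈ K) : ⟪p, p⟫ ≤ ⟪p, y⟫ := by
  have : Nonempty K := ⟨⟨p, hp⟩⟩
  have h : ‖(0 : E) - p‖ = ⨅ w : K, ‖(0 : E) - w‖ := by
    simp only [zero_sub, norm_neg]
    exact le_antisymm (le_ciInf fun w => hmin w w.2)
      (ciInf_le (f := fun w : K => ‖(w : E)‖) ⟨0, by rintro _ ⟨w, rfl⟩; positivity⟩ ⟨p, hp⟩)
  have := (norm_eq_iInf_iff_real_inner_le_zero hK hp).1 h y hy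
  rw [zero_sub, inner_neg_left, inner_sub_right] at this
  linarith

/-- A point `p ≠ 0` of `conv s` that minimizes `⟪p, ·⟫` there is a convex combination of linearly
independent points of `s`. -/
lemma exists_linearIndependent_of_mem_convexHull {s : Set E} {p : E} (hp0 : p ≠ 0)
    (hp : p ∈ convexHull ℝ s) (hmin : ∀ y ∈ convexHull ℝ s, ⟪p, p⟫ ≤ ⟪p, y⟫) :
    ∃ t : Finset E, (t : Set E) ⊆ s ∧ LinearIndependent ℝ (Subtype.val : t → E) ∧
      p ∈ convexHull ℝ (t : Set E) := by
  classical
  obtain ⟨κ, _, z, w, hz, hind, hw, hsum, hwz⟩ := eq_pos_convex_span_of_mem_convexHull hp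
  have hge : ∀ j, ⟪p, p⟫ ≤ ⟪p, z j⟫ := fun j => hmin _ (subset_convexHull ℝ s (hz ⟨j, rfl⟩))
  -- Since the weights are positive, all points lie on the supporting hyperplane at `p`.
  have heq : ∀ j, ⟪p, z j⟫ = ⟪p, p⟫ := by
    have hs : ∑ j, w j * (⟪p, z j⟫ - ⟪p, p⟫) = 0 := by
      have h1 : ∑ j, w j * ⟪p, z j⟫ = ⟪p, p⟫ := by
        have h := inner_sum (𝕜 := ℝ) Finset.univ (fun j => w j • z j) p
        rw [hwz] at h
        simpa only [real_inner_smul_right] using h.symm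
      simp only [mul_sub, Finset.sum_sub_distrib, h1, ← Finset.sum_mul, hsum, one_mul, sub_self]
    intro j
    have := (Finset.sum_eq_zero_iff_of_nonneg
      fun j _ => mul_nonneg (hw j).le (sub_nonneg.2 (hge j))).1 hs j (Finset.mem_univ j)
    rcases mul_eq_zero.1 this with h | h
    · exact absurd h (hw j).ne'
    · exact sub_eq_zero.1 h
  have hlin : LinearIndependent ℝ z := by
    rw [Fintype.linearIndependent_iff]
    intro a ha
    have hsum0 : ∑ j, a j = 0 := by
      have h := congrArg (fun x => ⟪p, x⟫) ha
      simp only [inner_sum, real_inner_smul_right, heq, inner_zero_right, ← Finset.sum_mul] at h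
      exact (mul_eq_zero.1 h).resolve_right (real_inner_self_pos.2 hp0).ne'
    exact fun j => affineIndependent_iff.1 hind Finset.univ a hsum0 ha j (Finset.mem_univ j)
  refine ⟨Finset.univ.image z, ?_, ?_, ?_⟩
  · simpa using hz
  · have := hlin.linearIndepOn_id
    rw [← Set.image_univ, ← Finset.coe_univ, ← Finset.coe_image] at this
    exact this
  · rw [← hwz]
    refine (convex_convexHull ℝ _).sum_mem (fun j _ => (hw j).le) hsum fun j _ => ?_
    exact subset_convexHull ℝ _ (by simp)

/-- Bárány's colorful Carathéodory theorem. The proof takes a point of minimal norm in the union of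
the images of all simplices with colors in `S`. -/
theorem exists_rainbow_zero_mem_convexHull [Fintype V] [DecidableEq ι] [FiniteDimensional ℝ E]
    (c : V → ι) (f : V → E) {W : Submodule ℝ E} {S : Finset ι} (hS : Module.finrank ℝ W < S.card)
    (hW : ∀ v, c v ∈ S → f v ∈ W) (h0 : ∀ i ∈ S, (0 : E) ∈ convexHull ℝ (f '' {v | c v = i})) :
    ∃ σ : Finset V, Set.InjOn c σ ∧ (∀ v ∈ σ, c v ∈ S) ∧
      (0 : E) ∈ convexHull ℝ (f '' (σ : Set V)) := by
  classical
  set T : Finset (Finset V) :=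
    Finset.univ.filter fun σ => Set.InjOn c (σ : Set V) ∧ ∀ v ∈ σ, c v ∈ S with hT
  set X : Set E := ⋃ σ ∈ T, convexHull ℝ (f '' (σ : Set V)) with hX
  have hmemX : ∀ {y : E} {σ : Finset V}, Set.InjOn c (σ : Set V) → (∀ v ∈ σ, c v ∈ S) →
      y ∈ convexHull ℝ (f '' (σ : Set V)) → y ∈ X := fun hinj hσ hy =>
    Set.mem_iUnion₂.2 ⟨_, by simp only [hT, Finset.mem_filter_univ]; exact ⟨hinj, hσ⟩, hy⟩
  have hcompact : IsCompact X :=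
    T.isCompact_biUnion fun σ _ => (σ.finite_toSet.image f).isCompact_convexHull ℝ
  have hnonempty : X.Nonempty := by
    obtain ⟨i, hi⟩ := Finset.card_pos.1 (hS.trans_le' (Nat.zero_le _))
    obtain ⟨_, v, hv, rfl⟩ := convexHull_nonempty_iff.1 ⟨_, h0 i hi⟩
    have hv : c v = i := hv
    exact ⟨f v, hmemX (σ := {v}) (by simp) (by simpa [hv] using hi) (by simp)⟩
  obtain ⟨p, hpX, hpmin⟩ := hcompact.exists_isMinOn hnonempty continuous_norm.continuousOn
  obtain ⟨σ, hσT, hpσ⟩ := Set.mem_iUnion₂.1 hpX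
  obtain ⟨hinj, hσS⟩ := (Finset.mem_filter_univ _).1 hσT
  by_cases hp0 : p = 0
  · exact ⟨σ, hinj, hσS, hp0 ▸ hpσ⟩
  exfalso
  have key : ∀ τ : Finset V, Set.InjOn c (τ : Set V) → (∀ v ∈ τ, c v ∈ S) →
      p ∈ convexHull ℝ (f '' (τ : Set V)) →
      ∀ y ∈ convexHull ℝ (f '' (τ : Set V)), ⟪p, p⟫ ≤ ⟪p, y⟫ := fun τ hτ hτS hpτ y hy =>
    inner_self_le_inner_of_forall_norm_le (convex_convexHull ℝ _) hpτ
      (fun y hy => hpmin (hmemX hτ hτS hy)) hy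
  obtain ⟨t, hts, hlin, hpt⟩ := exists_linearIndependent_of_mem_convexHull hp0 hpσ
    (key σ hinj hσS hpσ)
  obtain ⟨τ, hτσ, hτt⟩ := Set.SurjOn.exists_bijOn_subset hts
  lift τ to Finset V using τ.toFinite
  have hτS : ∀ v ∈ τ, c v ∈ S := fun v hv => hσS v (hτσ hv)
  have hpτ : p ∈ convexHull ℝ (f '' (τ : Set V)) := hτt.image_eq.symm ▸ hpt
  have hcard : τ.card < S.card := by
    refine lt_of_le_of_lt ?_ hS
    have htW : ∀ y ∈ t, y ∈ W := by
      intro y hy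
      obtain ⟨v, hv, rfl⟩ := hts hy
      exact hW v (hσS v hv)
    have hlinW : LinearIndependent ℝ fun y : t => (⟨y, htW y y.2⟩ : W) :=
      LinearIndependent.of_comp W.subtype hlin
    rw [Finset.card_nbij f hτt.mapsTo hτt.injOn hτt.surjOn]
    simpa using hlinW.fintype_card_le_finrank
  -- Some color of `S` is unused by `τ` and offers a vertex on the nonpositive side of `p`.
  obtain ⟨i, hiS, hi⟩ := Finset.exists_mem_notMem_of_card_lt_card
    (Finset.card_image_le.trans_lt hcard : (τ.image c).card < S.card)
  obtain ⟨v, hv, hpv⟩ : ∃ v, c v = i ∧ ⟪p, f v⟫ ≤ 0 := by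
    by_contra! hall
    have hsub : convexHull ℝ (f '' {v | c v = i}) ⊆ {x | 0 < ⟪p, x⟫} := by
      refine convexHull_min ?_ (convex_inner_pos p)
      rintro _ ⟨v, hv, rfl⟩
      exact hall v hv
    simpa using hsub (h0 i hiS)
  have hinsert : Set.InjOn c ((insert v τ : Finset V) : Set V) := by
    rw [Finset.coe_insert]
    refine (Set.injOn_insert fun hvτ => hi ?_).2 ⟨hinj.mono hτσ, ?_⟩
    · exact hv ▸ Finset.mem_image_of_mem c hvτ
    · rwa [hv, ← Finset.coe_image, Finset.mem_coe]
  have hle := key (insert v τ) hinsert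
    (fun x hx => (Finset.mem_insert.1 hx).elim (fun h => by rwa [h, hv]) (hτS x))
    (convexHull_mono (Set.image_mono (Finset.coe_subset.2 (Finset.subset_insert v τ))) hpτ) (f v)
    (subset_convexHull ℝ _ ⟨v, by simp, rfl⟩)
  exact (real_inner_self_pos.2 hp0).not_ge (hle.trans hpv)

end Caratheodory

/-! ### Reduction to the avoiding complex -/

/-- Gordan's alternative: the convex hull of finitely many points avoids the origin if and only if
some functional is positive on them. -/
lemma exists_mem_positiveSet_iff {V E : Type*} [NormedAddCommGroup E] [InnerProductSpace ℝ E]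
    [FiniteDimensional ℝ E] (f : V → E) (σ : Finset V) :
    (∃ u, u ∈ positiveSet f σ) ↔ (0 : E) ∉ convexHull ℝ (f '' (σ : Set V)) := by
  constructor
  · rintro ⟨u, hu⟩ h0
    have hsub : convexHull ℝ (f '' (σ : Set V)) ⊆ {x | 0 < ⟪u, x⟫} := by
      refine convexHull_min ?_ (convex_inner_pos u)
      rintro _ ⟨v, hv, rfl⟩
      have := mem_positiveSet.1 hu v hv
      rwa [real_inner_comm] at this
    simpa using hsub h0
  · intro h0
    obtain ⟨φ, s, hs, hφ⟩ := geometric_hahn_banach_point_closed (convex_convexHull ℝ _)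
      ((σ.finite_toSet.image f).isClosed_convexHull ℝ) h0
    refine ⟨(InnerProductSpace.toDual ℝ E).symm φ, mem_positiveSet.2 fun v hv => ?_⟩
    rw [real_inner_comm, InnerProductSpace.toDual_symm_apply]
    rw [map_zero] at hs
    exact hs.trans (hφ _ (subset_convexHull ℝ _ ⟨v, hv, rfl⟩))

/-- If the origin lies in the relative interior of `conv s`, a functional that is nonpositive on `s`
vanishes on `s`. -/
lemma inner_eq_zero_of_mem_intrinsicInterior {E : Type*} [NormedAddCommGroup E]
    [InnerProductSpace ℝ E] {s : Set E} (h0 : (0 : E) ∈ intrinsicInterior ℝ (convexHull ℝ s))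
    {u : E} (hu : ∀ x ∈ s, ⟪x, u⟫ ≤ 0) {x : E} (hx : x ∈ s) : ⟪x, u⟫ = 0 := by
  refine le_antisymm (hu x hx) ?_
  have hle : ∀ y ∈ convexHull ℝ s, ⟪u, y⟫ ≤ 0 := by
    refine fun y hy => convexHull_min (t := {y | ⟪u, y⟫ ≤ 0}) (fun y hy => ?_)
      (convex_halfSpace_le (innerₛₗ ℝ u).isLinear 0) hy
    exact (real_inner_comm y u).trans_le (hu y hy)
  obtain ⟨y, hy, hy0⟩ := mem_intrinsicInterior.1 h0
  have hxs : x ∈ affineSpan ℝ (convexHull ℝ s) :=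
    subset_affineSpan ℝ _ (subset_convexHull ℝ s hx)
  -- The point `-t • x` stays in `conv s` for some small `t > 0`.
  have hmem : ∀ t : ℝ, -t • x ∈ affineSpan ℝ (convexHull ℝ s) := fun t => by
    have := AffineMap.lineMap_mem (Q := affineSpan ℝ (convexHull ℝ s)) (-t) (hy0 ▸ y.2) hxs
    simpa [AffineMap.lineMap_apply] using this
  let g : ℝ → affineSpan ℝ (convexHull ℝ s) := fun t => ⟨-t • x, hmem t⟩
  have hgc : Continuous g := Continuous.subtype_mk (by fun_prop) _
  have hg0 : g 0 = y := Subtype.ext (by simp [g, hy0])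
  have hev : ∀ᶠ t in nhds (0 : ℝ), g t ∈
      interior (Subtype.val ⁻¹' convexHull ℝ s : Set (affineSpan ℝ (convexHull ℝ s))) :=
    hgc.continuousAt.eventually_mem (isOpen_interior.mem_nhds (hg0 ▸ hy))
  obtain ⟨t, ht, ht0⟩ := ((hev.filter_mono nhdsWithin_le_nhds).and
    (self_mem_nhdsWithin : Set.Ioi (0 : ℝ) ∈ nhdsWithin 0 (Set.Ioi 0))).exists
  have hts : -t • x ∈ convexHull ℝ s :=
    (interior_subset ht : g t ∈ Subtype.val ⁻¹' convexHull ℝ s)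
  have h := hle _ hts
  rw [real_inner_smul_right, real_inner_comm] at h
  have ht0 : 0 < t := ht0
  nlinarith

section Configurations

variable {d : ℕ} {n : Fin (d + 1) → ℕ} {f : Vertex n → EuclideanSpace ℝ (Fin d)}

lemma card_filter_le_one_iff_injOn (σ : Finset (Vertex n)) :
    (∀ i, (σ.filter fun v => v.1 = i).card ≤ 1) ↔ Set.InjOn Sigma.fst (σ : Set (Vertex n)) := by
  constructor
  · intro h v hv w hw hvw
    exact Finset.card_le_one.1 (h w.1) v (by simpa [hvw] using hv) w (by simpa using hw)
  · intro h i
    refine Finset.card_le_one.2 fun v hv w hw => ?_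
    rw [Finset.mem_filter] at hv hw
    exact h hv.1 hw.1 (hv.2.trans hw.2.symm)

lemma image_color_class (f : Vertex n → EuclideanSpace ℝ (Fin d)) (i : Fin (d + 1)) :
    f '' {v | v.1 = i} = Set.range fun j : Fin (n i) => f ⟨i, j⟩ := by
  ext x
  constructor
  · rintro ⟨⟨_, j⟩, rfl, rfl⟩
    exact ⟨j, rfl⟩
  · rintro ⟨j, rfl⟩
    exact ⟨⟨i, j⟩, rfl, rfl⟩

lemma IsCentered.balanced (h : IsCentered f) : Balanced Sigma.fst f := by
  intro i u hu v hv
  refine inner_eq_zero_of_mem_intrinsicInterior (h i) (u := u) ?_ ?_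
  · rw [← image_color_class]
    rintro _ ⟨w, hw, rfl⟩
    exact hu w hw
  · rw [← image_color_class]
    exact ⟨v, hv, rfl⟩

/-- By the colorful Carathéodory theorem, `s ≤ d` color classes in a space of dimension less than
`s` would capture the origin in a simplex with at most `d` vertices. -/
lemma IsCentered.spansEnough (h : IsCentered f) (hgen : InRelativeGeneralPosition f) :
    SpansEnough Sigma.fst f := by
  intro S L hL horth
  by_contra! hcard
  rw [Fintype.card_fin] at hcard
  have hfin := L.finrank_add_finrank_orthogonal
  rw [finrank_euclideanSpace_fin] at hfin
  have hpos : Module.finrank ℝ L ≠ 0 := fun h => hL (Submodule.finrank_eq_zero.1 h)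
  obtain ⟨S', hS'S, hS'⟩ := Finset.exists_subset_card_eq
    (show Module.finrank ℝ Lᗮ + 1 ≤ S.card by omega)
  obtain ⟨σ, hinj, hσ, h0⟩ := exists_rainbow_zero_mem_convexHull Sigma.fst f (W := Lᗮ) (S := S')
    (by omega)
    (fun v hv => (Submodule.mem_orthogonal' _ _).2 fun u hu => horth v (hS'S hv) u hu)
    (fun i _ => image_color_class f i ▸ intrinsicInterior_subset (h i))
  have hne : σ.Nonempty := by
    rw [Finset.nonempty_iff_ne_empty]
    rintro rfl
    simp at h0
  refine hgen σ ⟨hne, (card_filter_le_one_iff_injOn σ).2 hinj⟩ ?_ h0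
  have : σ.card ≤ S'.card := Finset.card_le_card_of_injOn Sigma.fst hσ hinj
  omega

lemma mem_positiveFamily_iff (f : Vertex n → EuclideanSpace ℝ (Fin d)) (σ : Finset (Vertex n)) :
    σ ∈ positiveFamily Sigma.fst f ⊤ Set.univ ↔ σ ∈ avoidingComplex f ∨ σ = ∅ := by
  have h : σ ∈ positiveFamily Sigma.fst f ⊤ Set.univ ↔
      Set.InjOn Sigma.fst (σ : Set (Vertex n)) ∧ (0 : EuclideanSpace ℝ (Fin d)) ∉ image f σ := by
    rw [image, ← exists_mem_positiveSet_iff, positiveFamily]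
    simp
  rw [h, ← card_filter_le_one_iff_injOn]
  rcases σ.eq_empty_or_nonempty with rfl | hσ
  · simp [image]
  · change _ ↔ ((σ.Nonempty ∧ _) ∧ _) ∨ _
    simp [hσ, hσ.ne_empty]

end Configurations

end Colorful

theorem theorem5 {d : ℕ} (n : Fin (d + 1) → ℕ) (hn : ∀ i, 2 ≤ n i)
    (f : Colorful.Vertex n → EuclideanSpace ℝ (Fin d))
    (hcentered : Colorful.IsCentered f)
    (hgeneral : Colorful.InRelativeGeneralPosition f) :
    (Colorful.avoidingComplex f).reducedBetti ((d : ℤ) - 1) = 1 := by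
  refine SetFamily.reducedBetti_eq_one (Colorful.mem_positiveFamily_iff f) ?_
  have h := Colorful.hasUniqueClass_positiveFamily hcentered.balanced
    (hcentered.spansEnough hgeneral) ⊤
  rwa [finrank_top, finrank_euclideanSpace_fin] at h
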